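/- **Setting.** An *L-algorithm* (a Las Vegas algorithm in $\mathrm{LV}(O(1))$) is a program $A$ together with a constant bound $b_A\in\mathbb N$ on the volume of computation. On an input $x\in\{0,1\}^*$ and with random bits $\alpha\in\{0,1\}^{\mathbb N}$ (independent fair coin tosses) it starts with remaining volume $b_A$; every operation uses up its cost, and the program stops without an output when the remaining volume does not suffice for the next operation. At any moment the program may stake any (rational) part of its remaining volume: the next bit of $\alpha$ decides whether the stake is lost or doubled, and the program learns the result. The concrete machine model is that of one-variable structured programs (assignment, composition, conditional, while-loop, bet) over binary trees, where each of the elementary operations (reading the variable, nil, cons, hd, tl) has unit cost and a composition step costs one unit; inputs and outputs are binary words, coded as lists. Put $$p_A(y/x)=\Pr_\alpha[A(x,\alpha)=y].$$ A family $p=(p(\cdot/x))_{x\in\{0,1\}^*}$ of (sub)probability distributions on $\{0,1\}^*$ is *samplable* if $p=p_A$ for some L-algorithm $A$. It is *complete* if it is samplable and for every samplable family $q$ there is a constant $c$ such that $q(y/x)\le c\,p(y/x)$ for all $x,y$. For a complete family $p$ and a set $X\subseteq\{0,1\}^*$ put $p(X/x)=\sum_{y\in X}p(y/x)$ and $\mathrm{Kl}_p(X/x)=-\log_2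 p(X/x)\in[0,\infty]$. **Proposition.** 1. There exists a complete samplable family of distributions. It can be obtained by choosing a random L-algorithm and running it: there are an L-algorithm $U$ for which $p_U$ is complete, and a prefix-free assignment of a word $\sigma_A\in\{0,1\}^*$ to every L-algorithm $A$ (if $\sigma_A$ is a prefix of $\sigma_B$, then $A=B$), such that for all $A$, $x$, $y$ and $\beta\in\{0,1\}^{\mathbb N}$, if $A(x,\beta)=y$, then $U(x,\sigma_A\beta)=y$. 2. Consequently there is an optimal inversion algorithm: for every complete samplable family $p$ there is an L-algorithm $A$ such that for every $f\colon\{0,1\}^*\to\{0,1\}^*$ and every $x$ $$\Pr_\alpha[A(x,\alpha)\in f^{-1}(x)]=2^{-\mathrm{Kl}_p(f^{-1}(x)/x)}$$ (with $2^{-\infty}=0$), and for every L-algorithm $B$ there is a constant $c$, not depending on $f$ and $x$, with $$\Pr_\alpha[B(x,\alpha)\in f^{-1}(x)]\le c\cdot\Pr_\alpha[A(x,\alpha)\in f^{-1}(x)]\quad\text{for all } f \text{ and } x.$$ -/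

import Mathlib

open MeasureTheory
open scoped ENNReal NNReal

namespace LasVegas

/-! ### Data and programs

The concrete machine model is the language of one-variable structured programs over binary trees
(pure list programs with unit-cost `cons`, `hd`, `tl`), extended by a betting command. -/

/-- Binary trees, the data on which programs act. -/
inductive Data : Type
  | nil : Data
  | cons : Data → Data → Data

namespace Data

/-- Only `nil` counts as "false". -/
def truth : Data → Bool
  | nil => false
  | cons _ _ => true

/-- The first component; `hd nil = nil`. -/
def hd : Data → Data
  | nil => nil
  | cons a _ => a

/-- The second component; `tl nil = nil`. -/
def tl : Data → Data
  | nil => nil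
  | cons _ b => b

/-- A single bit as a tree. -/
def ofBit : Bool → Data
  | false => nil
  | true => cons nil nil

/-- A binary word as a list of bits. -/
def ofBits : List Bool → Data
  | [] => nil
  | b :: l => cons (ofBit b) (ofBits l)

/-- The binary word listed along the right spine of a tree; a left inverse of `ofBits`. -/
def toBits : Data → List Bool
  | nil => []
  | cons a t => a.truth :: toBits t

/-- The natural number written in binary (least significant bit first) in a tree. -/
def toNat : Data → ℕ
  | nil => 0
  | cons a t => (if a.truth then 1 else 0) + 2 * toNat t

/-- The rational number of `[0, 1]` denoted by a tree: a pair of binary numerals `a`, `b` stands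
for the fraction `a / b`, cut off at `1`, and `nil` stands for `0`. -/
def toFraction (d : Data) : ℚ := min 1 ((d.hd.toNat : ℚ) / (d.tl.toNat : ℚ))

end Data

/-- Expressions in the only variable of a program. -/
inductive Exp : Type
  | var : Exp
  | nil : Exp
  | cons : Exp → Exp → Exp
  | hd : Exp → Exp
  | tl : Exp → Exp

namespace Exp

/-- The value of an expression if the variable has the value `d`. -/
def eval (d : Data) : Exp → Data
  | var => d
  | nil => Data.nil
  | cons E F => Data.cons (E.eval d) (F.eval d)
  | hd E => (E.eval d).hd
  | tl E => (E.eval d).tl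

/-- The number of elementary operations needed to evaluate an expression. -/
def size : Exp → ℕ
  | var => 1
  | nil => 1
  | cons E F => E.size + F.size + 1
  | hd E => E.size + 1
  | tl E => E.size + 1

end Exp

/-- Programs: assignment to the variable, composition, conditional, while-loop, and the command
`bet E C D`, which stakes the part of the remaining volume denoted by the value of `E` and
continues with `C` if the bet is won and with `D` if it is lost. -/
inductive Cmd : Type
  | assign : Exp → Cmd
  | seq : Cmd → Cmd → Cmd
  | ite : Exp → Cmd → Cmd → Cmd
  | loop : Exp → Cmd → Cmd
  | bet : Exp → Cmd → Cmd → Cmd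

/-- The volume used up by one execution of the outermost construct of a command. -/
def Cmd.cost : Cmd → ℕ
  | assign E => E.size
  | seq _ _ => 1
  | ite E _ _ => E.size
  | loop E _ => E.size
  | bet E _ _ => E.size

/-- A configuration of a running program. -/
structure Config where
  /-- the commands that remain to be executed -/
  control : List Cmd
  /-- the value of the variable -/
  value : Data
  /-- the remaining volume of computation -/
  volume : ℚ
  /-- the number of random bits read so far -/
  bitsRead : ℕ

/-- One step of computation with random bits `α`. There is no step if no command remains, or if
the remaining volume does not suffice for the next command. In a bet the next random bit
decides: the stake is doubled if the bit is `true`, and lost if it is `false`. -/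
def step (α : ℕ → Bool) (c : Config) : Option Config :=
  match c.control with
  | [] => none
  | C :: K =>
    if c.volume < C.cost then none
    else
      let v : ℚ := c.volume - C.cost
      match C with
      | .assign E => some ⟨K, E.eval c.value, v, c.bitsRead⟩
      | .seq C₁ C₂ => some ⟨C₁ :: C₂ :: K, c.value, v, c.bitsRead⟩
      | .ite E C₁ C₂ =>
        if (E.eval c.value).truth then some ⟨C₁ :: K, c.value, v, c.bitsRead⟩
        else some ⟨C₂ :: K, c.value, v, c.bitsRead⟩
      | .loop E C₁ =>
        if (E.eval c.value).truth then
          some ⟨C₁ :: .loop E C₁ :: K, c.value, v, c.bitsRead⟩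
        else some ⟨K, c.value, v, c.bitsRead⟩
      | .bet E C₁ C₂ =>
        let stake : ℚ := (E.eval c.value).toFraction * v
        if α c.bitsRead then some ⟨C₁ :: K, c.value, v + stake, c.bitsRead + 1⟩
        else some ⟨C₂ :: K, c.value, v - stake, c.bitsRead + 1⟩

/-- The program `C`, started on the input `x` with the volume `b` and the random bits `α`,
terminates with the output `y`. -/
def Computes (C : Cmd) (b : ℕ) (x : List Bool) (α : ℕ → Bool) (y : List Bool) : Prop :=
  ∃ c : Config,
    Relation.ReflTransGen (fun c₁ c₂ => step α c₁ = some c₂) ⟨[C], Data.ofBits x, b, 0⟩ c ∧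
      c.control = [] ∧ c.value.toBits = y

/-! ### L-algorithms and samplable families -/

/-- An L-algorithm: a betting program with a constant bound on the volume. -/
structure LAlgorithm where
  prog : Cmd
  bound : ℕ

/-- The L-algorithm `A` on the input `x` with the random bits `α` produces the output `y`. -/
def LAlgorithm.Outputs (A : LAlgorithm) (x : List Bool) (α : ℕ → Bool) (y : List Bool) : Prop :=
  Computes A.prog A.bound x α y

/-- The law of a sequence of independent fair coin tosses. -/
noncomputable def coin : Measure (ℕ → Bool) :=
  Measure.infinitePi fun _ => (PMF.uniformOfFintype Bool).toMeasure

/-- Families of (sub)probability distributions on binary words, parametrized by binary words: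
`p x y` is the probability of `y` for the parameter value `x`. -/
abbrev Family : Type := List Bool → List Bool → ℝ≥0∞

/-- The family of the output distributions of an L-algorithm. -/
noncomputable def LAlgorithm.family (A : LAlgorithm) : Family :=
  fun x y => coin {α | A.Outputs x α y}

/-- Samplable families. -/
def Samplable (p : Family) : Prop := ∃ A : LAlgorithm, p = A.family

/-- Complete samplable families: the largest ones up to a constant factor. -/
def Complete (p : Family) : Prop :=
  Samplable p ∧ ∀ q : Family, Samplable q → ∃ c : ℝ≥0, ∀ x y, q x y ≤ c * p x y

/-- The sequence that begins with the word `s` and continues with `β`. -/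
def prepend (s : List Bool) (β : ℕ → Bool) : ℕ → Bool :=
  fun n => (s[n]?).getD (β (n - s.length))

/-- `U` chooses an L-algorithm at random and runs it: every L-algorithm `A` has its own code word
`σ A` (no code word is a prefix of another one), and if the random bits of `U` begin with `σ A`,
then `U` runs `A` with the remaining random bits, giving at least those outputs that `A` gives. -/
def RunsRandomAlgorithm (U : LAlgorithm) : Prop :=
  ∃ σ : LAlgorithm → List Bool,
    (∀ A B, σ A <+: σ B → A = B) ∧
      ∀ A x β y, A.Outputs x β y → U.Outputs x (prepend (σ A) β) y

/-! ### Inversion -/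

/-- The probability of the set `X` for the parameter value `x`. -/
noncomputable def Family.prob (p : Family) (X : Set (List Bool)) (x : List Bool) : ℝ≥0∞ :=
  ∑' y : X, p x y

/-- `Kl(X/x) = -log₂ p(X/x)`, which is `⊤` if `p(X/x) = 0`. -/
noncomputable def Kl (p : Family) (X : Set (List Bool)) (x : List Bool) : EReal :=
  -(ENNReal.log (p.prob X x) / (Real.log 2 : ℝ))

/-- `2 ^ t` for extended real `t`, with `2 ^ ⊥ = 0`. -/
noncomputable def twoPow (t : EReal) : ℝ≥0∞ := EReal.exp (t * (Real.log 2 : ℝ))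

/-- The probability that `A`, given `x`, outputs a preimage of `x` under `f`. -/
noncomputable def LAlgorithm.inversionProb (A : LAlgorithm) (f : List Bool → List Bool)
    (x : List Bool) : ℝ≥0∞ :=
  coin {α | ∃ w, A.Outputs x α w ∧ f w = x}

end LasVegas

/-!
The universal algorithm `universal` reads a code word from its random bits and then interprets the
program that the word denotes, on the remaining random bits. Two points need care, both because
the bound on the volume of an L-algorithm is a constant: the bound for `universal` must not depend
on the algorithm that is interpreted, and interpretation must not spoil the bets.

*Gaining volume.* Every bit of the code word is preceded by a marker bit `true`, on which half of
the volume is staked (`readLoop_reads`). Code words are thus self-delimiting, and reading a long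
word leaves a large volume. Words are padded so that the volume at the end exceeds a fixed multiple
`slowdown` of the bound of the encoded algorithm; since a code word determines the program, the
length of the padding determines the bound, and the coding is injective
(`LAlgorithm.word_injective`).

*Interpretation.* Programs are compiled into code for a stack machine, each instruction of which
the main loop of `universal` executes at a cost of at most `instrCost`, independent of the
program. So a command of cost `m` is simulated at a cost proportional to `m`. When the program
stakes a fraction of its volume, the interpreter stakes the same fraction of its own, so the ratio
of the two volumes stays at least `slowdown`, up to a constant (`needed`, `simulate_step`). After
a bet the volume may be zero; the work that the interpreter has to do then is charged to the next
command of the program. It follows that `universal` finds every output of the interpreted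
algorithm (`mainLoop_simulates`, `universal_outputs`).

*Completeness.* If `U` behaves like `A` after the word `σ`, the output probabilities of `A` are at
most `2 ^ |σ|` times those of `U` (`coin_le_of_prepend`), because a sequence of coin tosses is a
first toss followed by a sequence of coin tosses, and output events are open, hence measurable.

*Inversion.* Outputs are unique, so that the probability of finding a preimage is the sum of the
output probabilities over the preimages (`LAlgorithm.inversionProb_eq_prob`). An algorithm that
samples a complete family is therefore an optimal inversion algorithm.
-/

namespace LasVegas

/-! ### Coin tossing -/

theorem prepend_nil (β : ℕ → Bool) : prepend [] β = β := by
  funext n; simp [prepend]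

theorem prepend_cons (b : Bool) (s : List Bool) (β : ℕ → Bool) :
    prepend (b :: s) β = prepend [b] (prepend s β) := by
  funext n
  cases n with
  | zero => simp [prepend]
  | succ n => simp [prepend]

theorem prepend_singleton_zero (b : Bool) (β : ℕ → Bool) : prepend [b] β 0 = b := by
  simp [prepend]

theorem prepend_singleton_succ (b : Bool) (β : ℕ → Bool) (n : ℕ) :
    prepend [b] β (n + 1) = β n := by
  simp [prepend]

theorem prepend_length_add (s : List Bool) (β : ℕ → Bool) (n : ℕ) :
    prepend s β (n + s.length) = β n := by
  simp [prepend]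

theorem measurable_prepend_singleton (b : Bool) : Measurable (prepend [b]) := by
  refine measurable_pi_lambda _ fun n => ?_
  cases n with
  | zero => simpa only [prepend_singleton_zero] using measurable_const
  | succ n => simpa only [prepend_singleton_succ] using measurable_pi_apply n

/-- A sequence of coin tosses is a first toss followed by a sequence of coin tosses. -/
theorem coin_eq_sum_map_prepend :
    coin = ∑ b : Bool, (2⁻¹ : ℝ≥0∞) • coin.map (prepend [b]) := by
  symm
  refine Measure.eq_infinitePi _ fun s t ht => ?_
  classical
  -- Enlarge `s` to an initial segment, so that the first coordinate can be split off.
  obtain ⟨N, hN⟩ : ∃ N, s ⊆ Finset.range (N + 1) :=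
    ⟨s.sup id, fun i hi => Finset.mem_range.2 (Nat.lt_succ_of_le (Finset.le_sup (f := id) hi))⟩
  set t' : ℕ → Set Bool := fun i => if i ∈ s then t i else Set.univ with ht'
  have hset : Set.pi (s : Set ℕ) t = Set.pi (Finset.range (N + 1) : Set ℕ) t' := by
    ext α
    simp only [Set.mem_pi, Finset.mem_coe, ht']
    constructor
    · intro h i _
      split_ifs with his
      · exact h i his
      · trivial
    · intro h i hi
      simpa [hi] using h i (hN hi)
  have hprod : ∏ i ∈ s, (PMF.uniformOfFintype Bool).toMeasure (t i)
      = ∏ i ∈ Finset.range (N + 1), (PMF.uniformOfFintype Bool).toMeasure (t' i) := by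
    rw [← Finset.prod_subset hN]
    · refine Finset.prod_congr rfl fun i hi => ?_
      simp [ht', hi]
    · intro i _ hi
      simp only [ht', hi, if_false, measure_univ]
  have hpre : ∀ b : Bool, prepend [b] ⁻¹' Set.pi (Finset.range (N + 1) : Set ℕ) t'
      = if b ∈ t' 0 then Set.pi (Finset.range N : Set ℕ) (fun i => t' (i + 1)) else ∅ := by
    intro b
    ext β
    have : prepend [b] β ∈ Set.pi (Finset.range (N + 1) : Set ℕ) t'
        ↔ b ∈ t' 0 ∧ ∀ i < N, β i ∈ t' (i + 1) := by
      simp only [Set.mem_pi, Finset.coe_range, Set.mem_Iio]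
      constructor
      · intro h
        refine ⟨by simpa only [prepend_singleton_zero] using h 0 (Nat.succ_pos _), fun i hi => ?_⟩
        simpa only [prepend_singleton_succ] using h (i + 1) (Nat.succ_lt_succ hi)
      · rintro ⟨h0, h⟩ i hi
        cases i with
        | zero => simpa only [prepend_singleton_zero] using h0
        | succ i => simpa only [prepend_singleton_succ] using h i (Nat.lt_of_succ_lt_succ hi)
    rw [Set.mem_preimage, this]
    split_ifs with hb <;> simp [hb]
  have hmeas : MeasurableSet (Set.pi (Finset.range (N + 1) : Set ℕ) t') :=
    MeasurableSet.pi (Finset.countable_toSet _) fun i _ => MeasurableSet.of_discrete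
  have hcoin : coin (Set.pi (Finset.range N : Set ℕ) (fun i => t' (i + 1)))
      = ∏ i ∈ Finset.range N, (PMF.uniformOfFintype Bool).toMeasure (t' (i + 1)) :=
    Measure.infinitePi_pi _ fun i _ => MeasurableSet.of_discrete
  rw [hset, hprod, Finset.prod_range_succ', ← hcoin, PMF.toMeasure_apply_fintype,
    Measure.finsetSum_apply, mul_comm, Finset.sum_mul]
  refine Finset.sum_congr rfl fun b _ => ?_
  rw [Measure.smul_apply, Measure.map_apply (measurable_prepend_singleton b) hmeas, hpre]
  by_cases hb : b ∈ t' 0 <;> simp [hb, Set.indicator]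

/-- Fixing the first random bits costs at most the probability of these bits. -/
theorem coin_le_of_prepend (s : List Bool) {S T : Set (ℕ → Bool)} (hT : MeasurableSet T)
    (h : ∀ β ∈ S, prepend s β ∈ T) : coin S ≤ 2 ^ s.length * coin T := by
  induction s generalizing S T with
  | nil => simpa using measure_mono fun β hβ => by simpa [prepend_nil] using h β hβ
  | cons b s ih =>
    have h1 := ih (S := S) (measurable_prepend_singleton b hT)
      fun β hβ => by simpa [← prepend_cons] using h β hβ
    have h2 : 2⁻¹ * coin (prepend [b] ⁻¹' T) ≤ coin T := by
      conv_rhs => rw [coin_eq_sum_map_prepend]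
      rw [Measure.finsetSum_apply]
      refine le_trans (le_of_eq ?_) (Finset.single_le_sum (fun _ _ => zero_le) (Finset.mem_univ b))
      rw [Measure.smul_apply, Measure.map_apply (measurable_prepend_singleton b) hT, smul_eq_mul]
    have h3 : coin (prepend [b] ⁻¹' T) ≤ 2 * coin T := by
      calc coin (prepend [b] ⁻¹' T) = 2 * (2⁻¹ * coin (prepend [b] ⁻¹' T)) := by
            rw [← mul_assoc, ENNReal.mul_inv_cancel two_ne_zero ENNReal.ofNat_ne_top, one_mul]
        _ ≤ 2 * coin T := by gcongr
    calc coin S ≤ 2 ^ s.length * coin (prepend [b] ⁻¹' T) := h1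
      _ ≤ 2 ^ s.length * (2 * coin T) := by gcongr
      _ = 2 ^ (b :: s).length * coin T := by rw [List.length_cons, pow_succ, mul_assoc]

/-! ### Output events -/

/-- A run reads only finitely many random bits. -/
theorem isOpen_reachable (c c' : Config) :
    IsOpen {α : ℕ → Bool | Relation.ReflTransGen (fun c₁ c₂ => step α c₁ = some c₂) c c'} := by
  refine isOpen_iff_mem_nhds.2 fun α hα => ?_
  change ∀ᶠ α' in nhds α, Relation.ReflTransGen (fun c₁ c₂ => step α' c₁ = some c₂) c c'
  replace hα : Relation.ReflTransGen (fun c₁ c₂ => step α c₁ = some c₂) c c' := hα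
  induction hα with
  | refl => exact Filter.Eventually.of_forall fun _ => .refl
  | @tail c₁ c₂ _ h ih =>
    have hbit : ∀ᶠ α' in nhds α, α' c₁.bitsRead = α c₁.bitsRead :=
      (continuous_apply c₁.bitsRead).continuousAt
        ((isOpen_discrete {α c₁.bitsRead}).mem_nhds rfl)
    filter_upwards [ih, hbit] with α' h₁ h₂
    refine h₁.tail ?_
    rw [← h]
    simp only [step, h₂]

theorem LAlgorithm.measurableSet_outputs (A : LAlgorithm) (x y : List Bool) :
    MeasurableSet {α | A.Outputs x α y} := by
  refine IsOpen.measurableSet ?_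
  simp only [LAlgorithm.Outputs, Computes, Set.ofPred_exists]
  refine isOpen_iUnion fun c => ?_
  by_cases h : c.control = [] ∧ c.value.toBits = y
  · simpa [h] using isOpen_reachable _ c
  · simp [h]

theorem eq_of_reachable {α : ℕ → Bool} {c c' : Config} (hc : c.control = [])
    (h : Relation.ReflTransGen (fun c₁ c₂ => step α c₁ = some c₂) c c') : c = c' := by
  rcases h.cases_head with rfl | ⟨d, hd, _⟩
  · rfl
  · simp [step, hc] at hd

theorem LAlgorithm.Outputs.unique {A : LAlgorithm} {x y y' : List Bool} {α : ℕ → Bool}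
    (h : A.Outputs x α y) (h' : A.Outputs x α y') : y = y' := by
  obtain ⟨c, hc, hk, rfl⟩ := h
  obtain ⟨c', hc', hk', rfl⟩ := h'
  have huniq : Relator.RightUnique (fun c₁ c₂ => step α c₁ = some c₂) :=
    fun a b d hab had => Option.some.inj (hab.symm.trans had)
  rcases Relation.ReflTransGen.total_of_right_unique huniq hc hc' with h | h
  · rw [eq_of_reachable hk h]
  · rw [eq_of_reachable hk' h]

theorem LAlgorithm.inversionProb_eq_prob (A : LAlgorithm) (f : List Bool → List Bool)
    (x : List Bool) : A.inversionProb f x = A.family.prob (f ⁻¹' {x}) x := by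
  have : {α | ∃ w, A.Outputs x α w ∧ f w = x}
      = ⋃ w : (f ⁻¹' {x} : Set (List Bool)), {α | A.Outputs x α w} := by
    ext α
    simp [and_comm]
  rw [LAlgorithm.inversionProb, this, measure_iUnion]
  · rfl
  · intro v w hvw
    refine Set.disjoint_left.2 fun α hv hw => hvw (Subtype.ext ?_)
    exact LAlgorithm.Outputs.unique (A := A) hv hw
  · exact fun w => A.measurableSet_outputs x w

/-- The value `∞` of the negative logarithm belongs to probability `0`, so the identity needs no
positivity assumption. -/
theorem twoPow_neg_Kl (p : Family) (X : Set (List Bool)) (x : List Bool) :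
    twoPow (-Kl p X x) = p.prob X x := by
  have h : ((Real.log 2 : ℝ) : EReal) ≠ 0 := by
    exact_mod_cast (Real.log_pos one_lt_two).ne'
  rw [twoPow, Kl, neg_neg, EReal.div_mul_cancel (EReal.coe_ne_bot _) (EReal.coe_ne_top _) h,
    ENNReal.exp_log]

theorem prob_le_of_le {p q : Family} {c : ℝ≥0} (h : ∀ x y, q x y ≤ c * p x y)
    (X : Set (List Bool)) (x : List Bool) : q.prob X x ≤ c * p.prob X x := by
  rw [Family.prob, Family.prob, ← ENNReal.tsum_mul_left]
  exact ENNReal.tsum_le_tsum fun y => h x y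

/-- The code word of an L-algorithm has positive probability, which is the constant lost. -/
theorem complete_of_runsRandomAlgorithm {U : LAlgorithm} (hU : RunsRandomAlgorithm U) :
    Complete U.family := by
  refine ⟨⟨U, rfl⟩, ?_⟩
  rintro _ ⟨A, rfl⟩
  obtain ⟨σ, -, hσ⟩ := hU
  refine ⟨2 ^ (σ A).length, fun x y => ?_⟩
  push_cast
  exact coin_le_of_prepend (σ A) (U.measurableSet_outputs x y) fun β hβ => hσ A x β y hβ

/-! ### Runs without bets -/

/-- Reachability between configurations with the random bits `α`. -/
abbrev Reaches (α : ℕ → Bool) : Config → Config → Prop :=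
  Relation.ReflTransGen fun c₁ c₂ => step α c₁ = some c₂

/-- The commands `k` with the value `d` lead to `k'` and `d'` without betting and using up at most
`W` of the volume, whatever the volume and the random bits are. -/
def Run (W : ℕ) (k : List Cmd) (d : Data) (k' : List Cmd) (d' : Data) : Prop :=
  ∀ (α : ℕ → Bool) (n : ℕ) (u : ℚ), (W : ℚ) ≤ u →
    ∃ u', u - W ≤ u' ∧ Reaches α ⟨k, d, u, n⟩ ⟨k', d', u', n⟩

theorem Run.refl (k : List Cmd) (d : Data) : Run 0 k d k d :=
  fun _ _ u _ => ⟨u, by simp, .refl⟩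

theorem Run.trans {W₁ W₂ : ℕ} {k₁ k₂ k₃ : List Cmd} {d₁ d₂ d₃ : Data}
    (h₁ : Run W₁ k₁ d₁ k₂ d₂) (h₂ : Run W₂ k₂ d₂ k₃ d₃) : Run (W₁ + W₂) k₁ d₁ k₃ d₃ := by
  intro α n u hu
  push_cast at hu ⊢
  have hW : (0 : ℚ) ≤ W₂ := Nat.cast_nonneg _
  obtain ⟨u₁, hu₁, r₁⟩ := h₁ α n u (by linarith)
  obtain ⟨u₂, hu₂, r₂⟩ := h₂ α n u₁ (by linarith)
  exact ⟨u₂, by linarith, r₁.trans r₂⟩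

theorem Run.mono {W W' : ℕ} {k k' : List Cmd} {d d' : Data} (h : Run W k d k' d')
    (hW : W ≤ W') : Run W' k d k' d' := by
  intro α n u hu
  have : (W : ℚ) ≤ W' := by exact_mod_cast hW
  obtain ⟨u', hu', r⟩ := h α n u (by linarith)
  exact ⟨u', by linarith, r⟩

theorem Run.of_step {C : Cmd} {k k' : List Cmd} {d d' : Data}
    (h : ∀ (α : ℕ → Bool) (n : ℕ) (u : ℚ), (C.cost : ℚ) ≤ u →
      step α ⟨C :: k, d, u, n⟩ = some ⟨k', d', u - C.cost, n⟩) :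
    Run C.cost (C :: k) d k' d' :=
  fun α n u hu => ⟨u - C.cost, le_rfl, .single (h α n u hu)⟩

theorem run_assign (E : Exp) (k : List Cmd) (d : Data) :
    Run E.size (.assign E :: k) d k (E.eval d) :=
  .of_step (C := .assign E) fun _ _ _ hu => by simp [step, not_lt.2 hu]

theorem run_seq (C₁ C₂ : Cmd) (k : List Cmd) (d : Data) :
    Run 1 (.seq C₁ C₂ :: k) d (C₁ :: C₂ :: k) d :=
  .of_step (C := .seq C₁ C₂) fun _ _ _ hu => by simp [step, not_lt.2 hu]

theorem run_ite (E : Exp) (C₁ C₂ : Cmd) (k : List Cmd) (d : Data) :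
    Run E.size (.ite E C₁ C₂ :: k) d ((if (E.eval d).truth then C₁ else C₂) :: k) d :=
  .of_step (C := .ite E C₁ C₂) fun _ _ _ hu => by
    by_cases h : (E.eval d).truth = true <;> simp [step, not_lt.2 hu, h]

theorem run_loop_true {E : Exp} {C : Cmd} {k : List Cmd} {d : Data}
    (h : (E.eval d).truth = true) :
    Run E.size (.loop E C :: k) d (C :: .loop E C :: k) d :=
  .of_step (C := .loop E C) fun _ _ _ hu => by simp [step, not_lt.2 hu, h]

theorem run_loop_false {E : Exp} {C : Cmd} {k : List Cmd} {d : Data}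
    (h : (E.eval d).truth = false) : Run E.size (.loop E C :: k) d k d :=
  .of_step (C := .loop E C) fun _ _ _ hu => by simp [step, not_lt.2 hu, h]

/-! ### Bets -/

theorem Data.toFraction_nonneg (d : Data) : 0 ≤ d.toFraction :=
  le_min zero_le_one (div_nonneg (Nat.cast_nonneg _) (Nat.cast_nonneg _))

theorem Data.toFraction_le_one (d : Data) : d.toFraction ≤ 1 := min_le_left _ _

theorem reaches_bet_true {α : ℕ → Bool} {E : Exp} {C D : Cmd} {k : List Cmd} {d : Data} {u : ℚ}
    {n : ℕ} (hu : (E.size : ℚ) ≤ u) (hα : α n = true) :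
    Reaches α ⟨.bet E C D :: k, d, u, n⟩
      ⟨C :: k, d, u - E.size + (E.eval d).toFraction * (u - E.size), n + 1⟩ :=
  .single (by simp [step, Cmd.cost, not_lt.2 hu, hα])

theorem reaches_bet_false {α : ℕ → Bool} {E : Exp} {C D : Cmd} {k : List Cmd} {d : Data} {u : ℚ}
    {n : ℕ} (hu : (E.size : ℚ) ≤ u) (hα : α n = false) :
    Reaches α ⟨.bet E C D :: k, d, u, n⟩
      ⟨D :: k, d, u - E.size - (E.eval d).toFraction * (u - E.size), n + 1⟩ :=
  .single (by simp [step, Cmd.cost, not_lt.2 hu, hα])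

/-! ### The machine code -/

/-- The number `n` in unary notation, used as an operation code. -/
def opcode : ℕ → Data
  | 0 => .nil
  | n + 1 => .cons .nil (opcode n)

/-- An instruction of the stack machine: an operation code and two arguments. The machine has a
control stack of instructions, one variable, and a stack of intermediate values. The operation
codes stand for: `0` continue with the two arguments in turn; `1` push the variable; `2` push
`nil`; `3`, `4`, `5` apply `cons`, `hd`, `tl` to the top of the value stack; `6` pop the variable;
`7` pop a value and continue with the first or the second argument, depending on its truth;
`8` pop a value and, if it is true, continue with the second argument, then the first one, then
the same instruction; `9` pop a value and stake the fraction that it denotes, continuing with the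
first argument after a win and with the second one after a loss. -/
def instr (n : ℕ) (a b : Data) : Data := .cons (opcode n) (.cons a b)

/-- The machine code of an expression: it pushes the value of the expression. -/
def Exp.code : Exp → Data
  | var => instr 1 .nil .nil
  | nil => instr 2 .nil .nil
  | cons E F => instr 0 E.code (instr 0 F.code (instr 3 .nil .nil))
  | hd E => instr 0 E.code (instr 4 .nil .nil)
  | tl E => instr 0 E.code (instr 5 .nil .nil)

/-- The machine code of a command. -/
def Cmd.code : Cmd → Data
  | assign E => instr 0 E.code (instr 6 .nil .nil)
  | seq C D => instr 0 C.code D.code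
  | ite E C D => instr 0 E.code (instr 7 C.code D.code)
  | loop E C => instr 0 E.code (instr 8 E.code C.code)
  | bet E C D => instr 0 E.code (instr 9 C.code D.code)

theorem Exp.code_injective : Function.Injective Exp.code := by
  intro E
  induction E with
  | var => intro F h; cases F <;> simp [Exp.code, instr, opcode] at h ⊢
  | nil => intro F h; cases F <;> simp [Exp.code, instr, opcode] at h ⊢
  | cons E₁ E₂ ih₁ ih₂ =>
    intro F h
    cases F <;> simp [Exp.code, instr, opcode] at h ⊢
    exact ⟨ih₁ h.1, ih₂ h.2⟩
  | hd E ih =>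
    intro F h
    cases F <;> simp [Exp.code, instr, opcode] at h ⊢
    exact ih h
  | tl E ih =>
    intro F h
    cases F <;> simp [Exp.code, instr, opcode] at h ⊢
    exact ih h

theorem Cmd.code_injective : Function.Injective Cmd.code := by
  intro C
  induction C with
  | assign E =>
    intro D h
    cases D with
    | assign F =>
      simp only [Cmd.code, instr, Data.cons.injEq, true_and, and_true] at h
      rw [Exp.code_injective h]
    | seq D₁ D₂ =>
      exfalso
      cases D₂ <;> simp [Cmd.code, instr, opcode] at h
    | _ => simp [Cmd.code, instr, opcode] at h
  | seq C₁ C₂ ih₁ ih₂ =>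
    intro D h
    cases D with
    | seq D₁ D₂ =>
      simp only [Cmd.code, instr, Data.cons.injEq, true_and] at h
      rw [ih₁ h.1, ih₂ h.2]
    | _ =>
      exfalso
      cases C₂ <;> simp [Cmd.code, instr, opcode] at h
  | ite E C₁ C₂ ih₁ ih₂ =>
    intro D h
    cases D with
    | ite F D₁ D₂ =>
      simp only [Cmd.code, instr, Data.cons.injEq, true_and] at h
      rw [Exp.code_injective h.1, ih₁ h.2.1, ih₂ h.2.2]
    | seq D₁ D₂ =>
      exfalso
      cases D₂ <;> simp [Cmd.code, instr, opcode] at h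
    | _ => simp [Cmd.code, instr, opcode] at h
  | loop E C ih =>
    intro D h
    cases D with
    | loop F D =>
      simp only [Cmd.code, instr, Data.cons.injEq, true_and] at h
      rw [Exp.code_injective h.1, ih h.2.2]
    | seq D₁ D₂ =>
      exfalso
      cases D₂ <;> simp [Cmd.code, instr, opcode] at h
    | _ => simp [Cmd.code, instr, opcode] at h
  | bet E C₁ C₂ ih₁ ih₂ =>
    intro D h
    cases D with
    | bet F D₁ D₂ =>
      simp only [Cmd.code, instr, Data.cons.injEq, true_and] at h
      rw [Exp.code_injective h.1, ih₁ h.2.1, ih₂ h.2.2]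
    | seq D₁ D₂ =>
      exfalso
      cases D₂ <;> simp [Cmd.code, instr, opcode] at h
    | _ => simp [Cmd.code, instr, opcode] at h

/-! ### The interpreter -/

/-- The command number `n` of a list, where `n` is the operation code denoted by `E`; operation
codes beyond the list select its last command. -/
def switch : List Cmd → Exp → Cmd
  | [], _ => .assign .var
  | [C], _ => C
  | C :: D :: l, E => .ite E (switch (D :: l) (.tl E)) C

/-- A machine state, as the value of the variable of the interpreter. -/
def machine (ctl val stk : Data) : Data := .cons ctl (.cons val stk)

namespace Interp

/-- The instruction to be executed. -/
def item : Exp := .hd (.hd .var)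
/-- The first argument of the instruction. -/
def arg₁ : Exp := .hd (.tl item)
/-- The second argument of the instruction. -/
def arg₂ : Exp := .tl (.tl item)
/-- The remaining control stack. -/
def rest : Exp := .tl (.hd .var)
/-- The simulated variable. -/
def val : Exp := .hd (.tl .var)
/-- The value stack. -/
def stk : Exp := .tl (.tl .var)
/-- The value on top of the stack. -/
def top : Exp := .hd stk
/-- The value stack without its top. -/
def pop : Exp := .tl stk

/-- Assignment of a machine state. -/
def set (c v s : Exp) : Cmd := .assign (.cons c (.cons v s))

/-- The routines that execute the instructions, ordered by operation code. -/
def routines : List Cmd :=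
  [set (.cons arg₁ (.cons arg₂ rest)) val stk,
   set rest val (.cons val stk),
   set rest val (.cons .nil stk),
   set rest val (.cons (.cons (.hd pop) top) (.tl pop)),
   set rest val (.cons (.hd top) pop),
   set rest val (.cons (.tl top) pop),
   set rest top pop,
   .ite top (set (.cons arg₁ rest) val pop) (set (.cons arg₂ rest) val pop),
   .ite top (set (.cons arg₂ (.cons (.cons .nil (.cons arg₁ item)) rest)) val pop)
     (set rest val pop),
   .bet top (set (.cons arg₁ rest) val pop) (set (.cons arg₂ rest) val pop)]

/-- The main loop of the interpreter: it executes instructions until the control stack is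
empty. -/
def mainLoop : Cmd := .loop (.hd .var) (switch routines (.hd item))

end Interp

open Interp

theorem run_switch (l : List Cmd) (E : Exp) (n : ℕ) (hn : n < l.length) (k : List Cmd) (d : Data)
    (h : E.eval d = opcode n) :
    Run (l.length * (E.size + l.length)) (switch l E :: k) d (l[n] :: k) d := by
  induction l generalizing E n with
  | nil => simp at hn
  | cons C l ih =>
    cases l with
    | nil =>
      obtain rfl : n = 0 := by simpa using hn
      exact (Run.refl _ _).mono (Nat.zero_le _)
    | cons D l =>
      have h₁ := run_ite E (switch (D :: l) (.tl E)) C k d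
      cases n with
      | zero =>
        rw [h] at h₁
        refine Run.mono h₁ ?_
        simp only [List.length_cons]
        nlinarith
      | succ n =>
        rw [h] at h₁
        have h₂ := ih (.tl E) n (by simpa using hn) (by simp [Exp.eval, h, opcode, Data.tl])
        refine Run.mono (h₁.trans h₂) ?_
        simp only [List.length_cons, Exp.size]
        nlinarith

/-- An upper bound on the cost of executing one instruction. -/
def instrCost : ℕ := 200

/-- The guard of the main loop costs `2`, and the choice among the ten routines at most
`10 * (4 + 10)`. -/
theorem run_mainLoop_routine (n : ℕ) (hn : n < 10) (a b ctl v s : Data) (k : List Cmd) :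
    Run 142 (mainLoop :: k) (machine (.cons (instr n a b) ctl) v s)
      (routines[n] :: mainLoop :: k) (machine (.cons (instr n a b) ctl) v s) :=
  ((run_loop_true rfl).trans (run_switch routines (.hd item) n hn _ _ rfl)).mono
    (by decide)

theorem run_mainLoop_assign {n : ℕ} (hn : n < 10) {a b ctl v s : Data} {c' v' s' : Exp}
    (k : List Cmd) (h : routines[n] = set c' v' s')
    (hs : c'.size + v'.size + s'.size ≤ 50 := by decide) :
    Run instrCost (mainLoop :: k) (machine (.cons (instr n a b) ctl) v s) (mainLoop :: k)
      (machine (c'.eval (machine (.cons (instr n a b) ctl) v s))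
        (v'.eval (machine (.cons (instr n a b) ctl) v s))
        (s'.eval (machine (.cons (instr n a b) ctl) v s))) := by
  have h₁ := run_mainLoop_routine n hn a b ctl v s k
  rw [h] at h₁
  refine (h₁.trans (run_assign _ _ _)).mono ?_
  simp only [Exp.size, instrCost]
  omega

theorem run_mainLoop_ite {n : ℕ} (hn : n < 10) {a b ctl v s : Data} {c₁ v₁ s₁ c₂ v₂ s₂ : Exp}
    (k : List Cmd) (h : routines[n] = .ite top (set c₁ v₁ s₁) (set c₂ v₂ s₂))
    (hs₁ : c₁.size + v₁.size + s₁.size ≤ 50 := by decide)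
    (hs₂ : c₂.size + v₂.size + s₂.size ≤ 50 := by decide) (x : Data) :
    Run instrCost (mainLoop :: k) (machine (.cons (instr n a b) ctl) v (.cons x s))
      (mainLoop :: k)
      (if x.truth then
        machine (c₁.eval (machine (.cons (instr n a b) ctl) v (.cons x s)))
        (v₁.eval (machine (.cons (instr n a b) ctl) v (.cons x s)))
        (s₁.eval (machine (.cons (instr n a b) ctl) v (.cons x s)))
      else
        machine (c₂.eval (machine (.cons (instr n a b) ctl) v (.cons x s)))
        (v₂.eval (machine (.cons (instr n a b) ctl) v (.cons x s)))
        (s₂.eval (machine (.cons (instr n a b) ctl) v (.cons x s)))) := by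
  have h₁ := run_mainLoop_routine n hn a b ctl v (.cons x s) k
  rw [h] at h₁
  have h₂ := h₁.trans (run_ite _ _ _ _ _)
  have hx : top.eval (machine (.cons (instr n a b) ctl) v (.cons x s)) = x := rfl
  have ht : top.size = 4 := rfl
  rw [hx, ht] at h₂
  split_ifs at h₂ ⊢
  · refine (h₂.trans (run_assign _ _ _)).mono ?_
    simp only [Exp.size, instrCost]
    omega
  · refine (h₂.trans (run_assign _ _ _)).mono ?_
    simp only [Exp.size, instrCost]
    omega

theorem run_instr_pair (a b ctl v s : Data) (k : List Cmd) :
    Run instrCost (mainLoop :: k) (machine (.cons (instr 0 a b) ctl) v s) (mainLoop :: k)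
      (machine (.cons a (.cons b ctl)) v s) :=
  run_mainLoop_assign (n := 0) (by decide) k rfl

theorem run_instr_pop (a b ctl v x s : Data) (k : List Cmd) :
    Run instrCost (mainLoop :: k) (machine (.cons (instr 6 a b) ctl) v (.cons x s)) (mainLoop :: k)
      (machine ctl x s) :=
  run_mainLoop_assign (n := 6) (by decide) k rfl

theorem run_instr_branch (a b ctl v x s : Data) (k : List Cmd) :
    Run instrCost (mainLoop :: k) (machine (.cons (instr 7 a b) ctl) v (.cons x s)) (mainLoop :: k)
      (machine (.cons (if x.truth then a else b) ctl) v s) := by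
  have := run_mainLoop_ite (n := 7) (a := a) (b := b) (ctl := ctl) (v := v) (s := s)
    (by decide) k rfl (x := x)
  split_ifs at this ⊢ <;> exact this

theorem run_instr_loop (a b ctl v x s : Data) (k : List Cmd) :
    Run instrCost (mainLoop :: k) (machine (.cons (instr 8 a b) ctl) v (.cons x s)) (mainLoop :: k)
      (machine (if x.truth then .cons b (.cons (instr 0 a (instr 8 a b)) ctl) else ctl) v s) := by
  have := run_mainLoop_ite (n := 8) (a := a) (b := b) (ctl := ctl) (v := v) (s := s)
    (by decide) k rfl (x := x)
  split_ifs at this ⊢ <;> exact this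

theorem run_exp_code (E : Exp) (ctl v s : Data) (k : List Cmd) :
    Run (3 * instrCost * E.size) (mainLoop :: k) (machine (.cons E.code ctl) v s) (mainLoop :: k)
      (machine ctl v (.cons (E.eval v) s)) := by
  induction E generalizing ctl s with
  | var =>
    exact (run_mainLoop_assign (n := 1) (by decide) k rfl).mono (by decide)
  | nil =>
    exact (run_mainLoop_assign (n := 2) (by decide) k rfl).mono (by decide)
  | cons E F ihE ihF =>
    have h₁ := (run_instr_pair E.code (instr 0 F.code (instr 3 .nil .nil)) ctl v s k).trans
      (ihE _ _)
    have h₂ := (h₁.trans (run_instr_pair _ _ _ _ _ k)).trans (ihF _ _)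
    have h₃ := h₂.trans (run_mainLoop_assign (n := 3) (by decide) k rfl)
    exact h₃.mono (by simp only [Exp.size, instrCost]; omega)
  | hd E ih =>
    have h₁ := (run_instr_pair E.code (instr 4 .nil .nil) ctl v s k).trans (ih _ _)
    have h₂ := h₁.trans (run_mainLoop_assign (n := 4) (by decide) k rfl)
    exact h₂.mono (by simp only [Exp.size, instrCost]; omega)
  | tl E ih =>
    have h₁ := (run_instr_pair E.code (instr 5 .nil .nil) ctl v s k).trans (ih _ _)
    have h₂ := h₁.trans (run_mainLoop_assign (n := 5) (by decide) k rfl)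
    exact h₂.mono (by simp only [Exp.size, instrCost]; omega)

/-! ### Simulation of a program -/

/-- The control stack of the machine that corresponds to a list of commands. -/
def ctlCode : List Cmd → Data
  | [] => .nil
  | C :: k => .cons C.code (ctlCode k)

/-- The factor by which the interpreter needs more volume than the interpreted program. A command
of cost `m` takes at most `5 * instrCost * m`; the rest makes up for the change of the constant
term in `needed`. -/
def slowdown : ℕ := 7 * instrCost

theorem Exp.one_le_size (E : Exp) : 1 ≤ E.size := by
  cases E <;> simp [Exp.size]

theorem Cmd.one_le_cost (C : Cmd) : 1 ≤ C.cost := by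
  cases C <;> simp [Cmd.cost, Exp.one_le_size]

/-- A configuration that can make a step has volume at least `1`. -/
theorem one_le_volume {β : ℕ → Bool} {c f : Config} (h : Reaches β c f) (hc : c.control ≠ [])
    (hf : f.control = []) : 1 ≤ c.volume := by
  rcases h.cases_head with rfl | ⟨d, hd, _⟩
  · exact absurd hf hc
  · obtain ⟨k, v, u, n⟩ := c
    cases k with
    | nil => exact absurd rfl hc
    | cons C k =>
      by_contra hlt
      have hC : (1 : ℚ) ≤ C.cost := by exact_mod_cast C.one_le_cost
      have : u < C.cost := lt_of_lt_of_le (not_le.1 hlt) hC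
      simp [step, this] at hd

/-- The volume with which the interpreter can simulate the run from a given configuration. The
constant `instrCost` covers the work between a simulated bet and the end of the round of the main
loop. After a bet nothing may be left to pay for it, so it is charged to the next command; there
is one, as the branches of a bet are commands. Once all commands have been executed, it must have
been kept in reserve in order to output the result. -/
def needed (c : Config) : ℚ :=
  slowdown * c.volume + if c.control = [] then (instrCost : ℚ) else -instrCost

theorem needed_of_ne_nil {c : Config} (hc : c.control ≠ []) :
    needed c = slowdown * c.volume - instrCost := by
  rw [needed, if_neg hc, sub_eq_add_neg]

theorem needed_le (c : Config) : needed c ≤ slowdown * c.volume + instrCost := by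
  have : (0 : ℚ) ≤ instrCost := Nat.cast_nonneg _
  rw [needed]
  split_ifs <;> linarith

/-- The configuration of the interpreter between two rounds of its main loop. -/
def simConfig (c : Config) (k : List Cmd) (L : ℕ) (u : ℚ) : Config :=
  ⟨mainLoop :: k, machine (ctlCode c.control) c.value .nil, u, c.bitsRead + L⟩

/-- The account for a command without a bet: of the `7 * instrCost` provided for each unit of its
cost `m`, two are left over and turn the constant term `-instrCost` of `needed` into `instrCost`,
in case this is the last command. -/
theorem simulate_of_run {α : ℕ → Bool} {c c' : Config} {k : List Cmd} {L m : ℕ} {u : ℚ}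
    (hc : c.control ≠ []) (hu : needed c ≤ u) (hm : 1 ≤ m)
    (hvol : c'.volume = c.volume - m) (hv' : 0 ≤ c'.volume) (hbits : c'.bitsRead = c.bitsRead)
    (hrun : Run (5 * instrCost * m) (mainLoop :: k) (machine (ctlCode c.control) c.value .nil)
      (mainLoop :: k) (machine (ctlCode c'.control) c'.value .nil)) :
    ∃ u', needed c' ≤ u' ∧ Reaches α (simConfig c k L u) (simConfig c' k L u') := by
  have hm' : (1 : ℚ) ≤ m := by exact_mod_cast hm
  rw [needed_of_ne_nil hc] at hu
  have hn := needed_le c'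
  simp only [slowdown, instrCost] at hu hn hrun
  push_cast at hu hn
  obtain ⟨u', hu', r⟩ := hrun α (c.bitsRead + L) u (by push_cast; linarith)
  push_cast at hu'
  refine ⟨u', by linarith, ?_⟩
  rw [simConfig, simConfig, hbits]
  exact r

theorem simulate_step {α β : ℕ → Bool} {L : ℕ} (hαβ : ∀ i, α (i + L) = β i) {c c' : Config}
    (hstep : step β c = some c') (hv : 0 ≤ c'.volume) (hv' : c'.control ≠ [] → 1 ≤ c'.volume)
    {k : List Cmd} {u : ℚ} (hu : needed c ≤ u) :
    ∃ u', needed c' ≤ u' ∧ Reaches α (simConfig c k L u) (simConfig c' k L u') := by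
  obtain ⟨ctl, d, v, n⟩ := c
  cases ctl with
  | nil => simp [step] at hstep
  | cons C ctl =>
  by_cases hlt : v < C.cost
  · simp [step, hlt] at hstep
  cases C with
  | assign E =>
    simp only [step, hlt, if_false, Option.some.injEq] at hstep
    subst hstep
    refine simulate_of_run (by simp) hu E.one_le_size rfl hv rfl ?_
    have h := ((run_instr_pair _ _ _ _ _ k).trans (run_exp_code E _ d .nil k)).trans
      (run_instr_pop .nil .nil (ctlCode ctl) _ _ _ k)
    refine Run.mono h ?_
    have := E.one_le_size
    simp only [instrCost]
    omega
  | seq C₁ C₂ =>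
    simp only [step, hlt, if_false, Option.some.injEq] at hstep
    subst hstep
    refine simulate_of_run (by simp) hu le_rfl rfl hv rfl ?_
    exact (run_instr_pair _ _ _ _ _ k).mono (by decide)
  | ite E C₁ C₂ =>
    have h := ((run_instr_pair _ _ _ _ _ k).trans (run_exp_code E _ d .nil k)).trans
      (run_instr_branch C₁.code C₂.code (ctlCode ctl) d _ _ k)
    replace h : Run (5 * instrCost * E.size) _ _ _ _ := Run.mono h (by
      have := E.one_le_size
      simp only [instrCost]
      omega)
    simp only [step, hlt, if_false] at hstep
    split_ifs at hstep h
    all_goals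
      simp only [Option.some.injEq] at hstep
      subst hstep
      exact simulate_of_run (by simp) hu E.one_le_size rfl hv rfl h
  | loop E C =>
    have h := ((run_instr_pair _ _ _ _ _ k).trans (run_exp_code E _ d .nil k)).trans
      (run_instr_loop E.code C.code (ctlCode ctl) d _ _ k)
    replace h : Run (5 * instrCost * E.size) _ _ _ _ := Run.mono h (by
      have := E.one_le_size
      simp only [instrCost]
      omega)
    simp only [step, hlt, if_false] at hstep
    split_ifs at hstep h
    all_goals
      simp only [Option.some.injEq] at hstep
      subst hstep
      exact simulate_of_run (by simp) hu E.one_le_size rfl hv rfl h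
  | bet E C₁ C₂ =>
    have hE : (1 : ℚ) ≤ E.size := by exact_mod_cast E.one_le_size
    rw [needed_of_ne_nil (by simp)] at hu
    replace hlt : (E.size : ℚ) ≤ v := not_lt.1 hlt
    have h := ((run_instr_pair _ _ _ _ _ k).trans (run_exp_code E _ d .nil k)).trans
      (run_mainLoop_routine 9 (by decide) C₁.code C₂.code (ctlCode ctl) d _ k)
    simp only [slowdown, instrCost] at hu h
    push_cast at hu
    obtain ⟨u₁, hu₁, r₁⟩ := h α (n + L) u (by push_cast; linarith)
    push_cast at hu₁
    have hu₁' : slowdown * (v - E.size) ≤ u₁ - top.size := by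
      simp only [slowdown, instrCost, top, stk, Exp.size]
      push_cast
      linarith
    have hu₁'' : (top.size : ℚ) ≤ u₁ := by
      have : (0 : ℚ) ≤ slowdown * (v - E.size) := mul_nonneg (Nat.cast_nonneg _) (by linarith)
      linarith
    -- The interpreter stakes the same part of its volume as the program, so that their ratio
    -- is not affected by the outcome.
    set q : ℚ := (E.eval d).toFraction with hq
    have hq₀ : 0 ≤ q := Data.toFraction_nonneg _
    have hq₁ : q ≤ 1 := Data.toFraction_le_one _
    have hafter : ∀ (C : Cmd) (a : Exp) (v' u₂ : ℚ), 1 ≤ v' → slowdown * v' ≤ u₂ →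
        a.size ≤ 10 →
        a.eval (machine (.cons (instr 9 C₁.code C₂.code) (ctlCode ctl)) d
          (.cons (E.eval d) .nil)) = C.code →
        ∃ u', needed ⟨C :: ctl, d, v', n + 1⟩ ≤ u' ∧
          Reaches α ⟨set (.cons a rest) val pop :: mainLoop :: k,
            machine (.cons (instr 9 C₁.code C₂.code) (ctlCode ctl)) d (.cons (E.eval d) .nil),
            u₂, n + L + 1⟩ (simConfig ⟨C :: ctl, d, v', n + 1⟩ k L u') := by
      intro C a v' u₂ h1 h2 ha hC
      have hrun := (run_assign (.cons (.cons a rest) (.cons val pop)) (mainLoop :: k)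
        (machine (.cons (instr 9 C₁.code C₂.code) (ctlCode ctl)) d
          (.cons (E.eval d) .nil))).mono (W' := instrCost) (by
            simp only [Exp.size, rest, val, pop, stk, instrCost]; omega)
      simp only [slowdown, instrCost] at h2 hrun
      push_cast at h2
      obtain ⟨u', hu', r⟩ := hrun α (n + L + 1) u₂ (by push_cast; linarith)
      refine ⟨u', ?_, ?_⟩
      · rw [needed_of_ne_nil (by simp)]
        simp only [slowdown, instrCost]
        push_cast at hu' ⊢
        linarith
      · have hbits : n + L + 1 = n + 1 + L := by omega
        rw [simConfig, ctlCode, ← hC, ← hbits]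
        exact r
    by_cases hβ : β n = true
    · simp only [step, not_lt.2 hlt, if_false, hβ, if_true, Option.some.injEq, Cmd.cost] at hstep
      subst hstep
      have hb := reaches_bet_true (C := set (.cons arg₁ rest) val pop)
        (D := set (.cons arg₂ rest) val pop) (k := mainLoop :: k) (E := top)
        (d := machine (.cons (instr 9 C₁.code C₂.code) (ctlCode ctl)) d (.cons (E.eval d) .nil))
        hu₁'' ((hαβ n).trans hβ)
      obtain ⟨u', hu', r⟩ := hafter C₁ arg₁ _
        (u₁ - top.size + q * (u₁ - top.size)) (hv' (by simp)) (by nlinarith) (by decide) rfl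
      exact ⟨u', hu', (r₁.trans hb).trans r⟩
    · replace hβ : β n = false := Bool.eq_false_of_not_eq_true hβ
      simp only [step, not_lt.2 hlt, if_false, hβ, Bool.false_eq_true, Option.some.injEq,
        Cmd.cost] at hstep
      subst hstep
      have hb := reaches_bet_false (C := set (.cons arg₁ rest) val pop)
        (D := set (.cons arg₂ rest) val pop) (k := mainLoop :: k) (E := top)
        (d := machine (.cons (instr 9 C₁.code C₂.code) (ctlCode ctl)) d (.cons (E.eval d) .nil))
        hu₁'' ((hαβ n).trans hβ)
      obtain ⟨u', hu', r⟩ := hafter C₂ arg₂ _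
        (u₁ - top.size - q * (u₁ - top.size)) (hv' (by simp)) (by nlinarith) (by decide) rfl
      exact ⟨u', hu', (r₁.trans hb).trans r⟩

theorem volume_nonneg_of_step {β : ℕ → Bool} {c c' : Config} (h : step β c = some c') :
    0 ≤ c'.volume := by
  obtain ⟨ctl, d, v, n⟩ := c
  cases ctl with
  | nil => simp [step] at h
  | cons C ctl =>
    by_cases hlt : v < C.cost
    · simp [step, hlt] at h
    have hC : 0 ≤ v - C.cost := by linarith
    have hstake : ∀ x : Data, 0 ≤ v - C.cost + x.toFraction * (v - C.cost) ∧
        0 ≤ v - C.cost - x.toFraction * (v - C.cost) := fun x => by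
      have h₀ := x.toFraction_nonneg
      have h₁ := x.toFraction_le_one
      constructor <;> nlinarith
    cases C <;> simp only [step, hlt, if_false] at h <;> (try split_ifs at h) <;>
      simp only [Option.some.injEq] at h <;> subst h <;>
      first
        | exact hC
        | exact (hstake _).1
        | exact (hstake _).2

/-- If the random bits of the interpreter are, from the place `L` on, those of the interpreted
program, and if its volume is sufficient, then it finds the value that the program computes. -/
theorem mainLoop_simulates {α β : ℕ → Bool} {L : ℕ} (hαβ : ∀ i, α (i + L) = β i)
    {c f : Config} (h : Reaches β c f) (hf : f.control = []) (hv : 0 ≤ c.volume) {u : ℚ}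
    (hu : needed c ≤ u) :
    ∃ u', Reaches α (simConfig c [.assign val] L u) ⟨[], f.value, u', f.bitsRead + L⟩ := by
  induction h using Relation.ReflTransGen.head_induction_on generalizing u with
  | refl =>
    rw [needed, if_pos hf] at hu
    have hs : (0 : ℚ) ≤ slowdown * f.volume := mul_nonneg (Nat.cast_nonneg _) hv
    have hguard :
        ((Exp.hd .var).eval (machine (ctlCode f.control) f.value .nil)).truth = false := by
      rw [hf]; rfl
    have hrun := ((run_loop_false (C := switch routines (.hd item)) (k := [.assign val])
      hguard).trans (run_assign _ _ _)).mono (W' := instrCost) (by decide)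
    obtain ⟨u', -, r⟩ := hrun α (f.bitsRead + L) u (by linarith)
    exact ⟨u', r⟩
  | head hstep hrest ih =>
    have hv' := volume_nonneg_of_step hstep
    obtain ⟨u₁, hu₁, r₁⟩ := simulate_step hαβ hstep hv' (fun hc => one_le_volume hrest hc hf)
      (k := [.assign val]) hu
    obtain ⟨u₂, r₂⟩ := ih hv' hu₁
    exact ⟨u₂, r₁.trans r₂⟩

/-! ### Reading a code word -/

/-- One step in building a tree from its postfix notation: `false` pushes `nil`, and `true`
combines the two trees on top of the stack. -/
def build (s : Data) : Bool → Data
  | false => .cons .nil s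
  | true => .cons (.cons s.tl.hd s.hd) s.tl.tl

/-- The postfix notation of a tree. -/
def postfixWord : Data → List Bool
  | .nil => [false]
  | .cons a b => postfixWord a ++ postfixWord b ++ [true]

theorem foldl_build_postfixWord (d s : Data) : (postfixWord d).foldl build s = .cons d s := by
  induction d generalizing s with
  | nil => rfl
  | cons a b iha ihb => simp [postfixWord, List.foldl_append, iha, ihb, build, Data.hd, Data.tl]

/-- A self-delimiting form of a word: each bit is preceded by `true`, and the end is marked by
`false`. -/
def frame : List Bool → List Bool
  | [] => [false]
  | b :: l => true :: b :: frame l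

theorem eq_of_frame_prefix {l l' : List Bool} (h : frame l <+: frame l') : l = l' := by
  induction l generalizing l' with
  | nil => cases l' <;> simp [frame] at h ⊢
  | cons b l ih =>
    cases l' with
    | nil => simp [frame] at h
    | cons b' l' =>
      simp only [frame, List.cons_prefix_cons, true_and] at h
      rw [h.1, ih h.2]

namespace Interp

/-- The tree that denotes "true". -/
def one : Exp := .cons .nil .nil

/-- The fraction `1 / 2`. -/
def half : Exp := .cons (.cons one .nil) (.cons .nil (.cons one .nil))

/-- The command that reads one bit of a word in postfix notation and executes `build`. -/
def readBit : Cmd :=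
  .bet .nil (set one val (.cons (.cons (.hd pop) top) (.tl pop))) (set one val (.cons .nil stk))

/-- The loop that reads a framed word in postfix notation. The variable has the form of a machine
state, whose control part is used as a flag and whose value stack receives the trees. The stake
of one half on every marker increases the volume as long as there are further bits, and leaves
half of it at the end. -/
def readLoop : Cmd := .loop (.hd .var) (.bet half readBit (set .nil val stk))

end Interp

theorem toFraction_half (d : Data) : (half.eval d).toFraction = 1 / 2 := by
  simp [half, one, Exp.eval, Data.toFraction, Data.hd, Data.tl, Data.toNat, Data.truth]
  norm_num

theorem toFraction_nil : Data.nil.toFraction = 0 := by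
  simp [Data.toFraction, Data.hd, Data.tl, Data.toNat]

theorem readLoop_bit {α : ℕ → Bool} {n : ℕ} {u : ℚ} {b : Bool} (h₁ : α n = true)
    (h₂ : α (n + 1) = b) (hu : 500 ≤ u) (x s : Data) (k : List Cmd) :
    ∃ u', u + 1 ≤ u' ∧
      Reaches α ⟨readLoop :: k, machine (.cons .nil .nil) x s, u, n⟩
        ⟨readLoop :: k, machine (.cons .nil .nil) x (build s b), u', n + 2⟩ := by
  obtain ⟨u₁, hu₁, r₁⟩ := (run_loop_true (E := .hd .var)
    (C := .bet half readBit (set .nil val stk)) (k := k)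
    (d := machine (.cons .nil .nil) x s) rfl) α n u (by simp only [Exp.size]; push_cast; linarith)
  have r₂ := r₁.trans (reaches_bet_true (by simp only [half, one, Exp.size] at hu₁ ⊢
                                            push_cast at hu₁ ⊢; linarith) h₁)
  rw [toFraction_half] at r₂
  set u₂ := u₁ - half.size + 1 / 2 * (u₁ - half.size) with hu₂
  have hu₂' : 3 / 2 * u - 30 ≤ u₂ := by
    simp only [half, one, Exp.size] at hu₁ hu₂
    push_cast at hu₁ hu₂
    linarith
  have hfirst : (Exp.nil.size : ℚ) ≤ u₂ := by simp only [Exp.size]; push_cast; linarith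
  cases b with
  | true =>
    have r₃ := r₂.trans (reaches_bet_true hfirst h₂)
    simp only [Exp.eval, toFraction_nil, zero_mul, add_zero] at r₃
    obtain ⟨u₄, hu₄, r₄⟩ := ((run_assign
      (.cons one (.cons val (.cons (.cons (.hd pop) top) (.tl pop)))) (readLoop :: k)
      (machine (.cons .nil .nil) x s)).mono (W' := 100) (by decide)) α (n + 1 + 1)
      (u₂ - Exp.nil.size) (by simp only [Exp.size]; push_cast; linarith)
    refine ⟨u₄, ?_, r₃.trans r₄⟩
    simp only [Exp.size] at hu₄
    push_cast at hu₄
    linarith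
  | false =>
    have r₃ := r₂.trans (reaches_bet_false hfirst h₂)
    simp only [Exp.eval, toFraction_nil, zero_mul, sub_zero] at r₃
    obtain ⟨u₄, hu₄, r₄⟩ := ((run_assign (.cons one (.cons val (.cons .nil stk)))
      (readLoop :: k) (machine (.cons .nil .nil) x s)).mono (W' := 100) (by decide)) α (n + 1 + 1)
      (u₂ - Exp.nil.size) (by simp only [Exp.size]; push_cast; linarith)
    refine ⟨u₄, ?_, r₃.trans r₄⟩
    simp only [Exp.size] at hu₄
    push_cast at hu₄
    linarith

theorem readLoop_end {α : ℕ → Bool} {n : ℕ} {u : ℚ} (h : α n = false) (hu : 500 ≤ u)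
    (x s : Data) (k : List Cmd) :
    ∃ u', u / 2 - 50 ≤ u' ∧
      Reaches α ⟨readLoop :: k, machine (.cons .nil .nil) x s, u, n⟩
        ⟨k, machine .nil x s, u', n + 1⟩ := by
  obtain ⟨u₁, hu₁, r₁⟩ := (run_loop_true (E := .hd .var)
    (C := .bet half readBit (set .nil val stk)) (k := k)
    (d := machine (.cons .nil .nil) x s) rfl) α n u (by simp only [Exp.size]; push_cast; linarith)
  have r₂ := r₁.trans (reaches_bet_false (by simp only [half, one, Exp.size] at hu₁ ⊢
                                             push_cast at hu₁ ⊢; linarith) h)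
  rw [toFraction_half] at r₂
  set u₂ := u₁ - half.size - 1 / 2 * (u₁ - half.size) with hu₂
  have hu₂' : u / 2 - 10 ≤ u₂ := by
    simp only [half, one, Exp.size] at hu₁ hu₂
    push_cast at hu₁ hu₂
    linarith
  obtain ⟨u₃, hu₃, r₃⟩ := (((run_assign (.cons .nil (.cons val stk)) (readLoop :: k)
    (machine (.cons .nil .nil) x s)).trans (run_loop_false rfl)).mono (W' := 40)
    (by decide)) α (n + 1) u₂ (by push_cast; linarith)
  refine ⟨u₃, ?_, r₂.trans r₃⟩
  push_cast at hu₃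
  linarith

/-- Reading a word, the interpreter gains at least one unit of volume for every bit. -/
theorem readLoop_reads {α β : ℕ → Bool} (l : List Bool) {n : ℕ} {u : ℚ}
    (hα : ∀ i, α (i + n) = prepend (frame l) β i) (hu : 500 ≤ u) (x s : Data) (k : List Cmd) :
    ∃ u', (u + l.length) / 2 - 50 ≤ u' ∧
      Reaches α ⟨readLoop :: k, machine (.cons .nil .nil) x s, u, n⟩
        ⟨k, machine .nil x (l.foldl build s), u', n + (frame l).length⟩ := by
  induction l generalizing n u s with
  | nil =>
    have h : α n = false := by simpa [frame, prepend] using hα 0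
    simpa [frame] using readLoop_end h hu x s k
  | cons b l ih =>
    have h₁ : α n = true := by simpa [frame, prepend] using hα 0
    have h₂ : α (n + 1) = b := by simpa [frame, prepend, add_comm] using hα 1
    obtain ⟨u₁, hu₁, r₁⟩ := readLoop_bit h₁ h₂ hu x s k
    have hα' : ∀ i, α (i + (n + 2)) = prepend (frame l) β i := fun i => by
      have := hα (i + 2)
      rw [frame, prepend_cons, prepend_singleton_succ, prepend_cons, prepend_singleton_succ] at this
      rw [← this]
      congr 1
      omega
    obtain ⟨u₂, hu₂, r₂⟩ := ih hα' (by linarith) (build s b)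
    refine ⟨u₂, ?_, ?_⟩
    · rw [List.length_cons]
      push_cast
      linarith
    · have hlen : n + (frame (b :: l)).length = n + 2 + (frame l).length := by
        simp only [frame, List.length_cons]
        omega
      rw [hlen, List.foldl_cons]
      exact r₁.trans r₂

/-! ### The universal algorithm -/

/-- The L-algorithm that reads a code word and interprets the program that it denotes. Its bound
is large enough for the volume to grow with the first bit read. -/
def universal : LAlgorithm where
  prog := .seq (set one .var .nil) (.seq readLoop
    (.seq (set (.cons top .nil) val .nil) (.seq mainLoop (.assign val))))
  bound := 1000

/-- The word to be read for running `A`: the postfix notation of its program, preceded by symbols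
for superfluous trees `nil`, as many as needed for gaining the volume that the simulation of `A`
requires. -/
def LAlgorithm.word (A : LAlgorithm) : List Bool :=
  List.replicate (2 * slowdown * A.bound) false ++ postfixWord A.prog.code

theorem LAlgorithm.foldl_build_word (A : LAlgorithm) :
    ∃ s, A.word.foldl build .nil = .cons A.prog.code s := by
  rw [LAlgorithm.word, List.foldl_append, foldl_build_postfixWord]
  exact ⟨_, rfl⟩

theorem LAlgorithm.word_injective : Function.Injective LAlgorithm.word := by
  intro A B h
  have hprog : A.prog = B.prog := by
    obtain ⟨s, hs⟩ := A.foldl_build_word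
    obtain ⟨t, ht⟩ := B.foldl_build_word
    rw [h, ht, Data.cons.injEq] at hs
    exact Cmd.code_injective hs.1.symm
  have hbound : A.bound = B.bound := by
    have hlen := congrArg List.length h
    simp only [LAlgorithm.word, List.length_append, List.length_replicate, hprog, slowdown,
      instrCost] at hlen
    omega
  cases A
  cases B
  simp_all

theorem universal_outputs {A : LAlgorithm} {x y : List Bool} {β : ℕ → Bool}
    (h : A.Outputs x β y) : universal.Outputs x (prepend (frame A.word) β) y := by
  obtain ⟨f, hrun, hf, rfl⟩ := h
  set α := prepend (frame A.word) β with hα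
  -- Prepare the variable for the reading loop.
  have hinit := ((run_seq (set one .var .nil) (.seq readLoop
    (.seq (set (.cons top .nil) val .nil) (.seq mainLoop (.assign val)))) []
      (Data.ofBits x)).trans ((run_assign _ _ _).trans (run_seq _ _ _ _))).mono (W' := 50)
      (by decide)
  obtain ⟨u₁, hu₁, r₁⟩ := hinit α 0 universal.bound (by simp only [universal]; norm_num)
  obtain ⟨u₂, hu₂, r₂⟩ := readLoop_reads (α := α) (β := β) A.word (n := 0) (u := u₁)
    (fun i => rfl) (by simp only [universal] at hu₁; push_cast at hu₁; linarith)
    (Data.ofBits x) .nil [.seq (set (.cons top .nil) val .nil) (.seq mainLoop (.assign val))]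
  have hlen : (2 * slowdown * A.bound : ℚ) ≤ A.word.length := by
    have : 2 * slowdown * A.bound ≤ A.word.length := by simp [LAlgorithm.word]
    exact_mod_cast this
  have hu₂' : slowdown * A.bound + 100 ≤ u₂ := by
    simp only [universal] at hu₁
    push_cast at hu₁
    linarith
  have hpos : (0 : ℚ) ≤ slowdown * A.bound := by positivity
  -- Put the program on the control stack.
  have hload := ((run_seq (set (.cons top .nil) val .nil) (.seq mainLoop (.assign val)) []
    (machine .nil (Data.ofBits x) (A.word.foldl build .nil))).trans
      ((run_assign _ _ _).trans (run_seq _ _ _ _))).mono (W' := 50) (by decide)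
  obtain ⟨u₃, hu₃, r₃⟩ := hload α (0 + (frame A.word).length) u₂ (by push_cast; linarith)
  obtain ⟨s, hs⟩ := A.foldl_build_word
  rw [hs] at r₂ r₃
  have hneed : needed ⟨[A.prog], Data.ofBits x, A.bound, 0⟩ ≤ u₃ := by
    rw [needed_of_ne_nil (by simp)]
    simp only [instrCost]
    push_cast at hu₃ ⊢
    linarith
  obtain ⟨u₄, r₄⟩ := mainLoop_simulates (α := α) (prepend_length_add (frame A.word) β) hrun hf
    (Nat.cast_nonneg _) hneed
  exact ⟨_, ((r₁.trans r₂).trans r₃).trans r₄, rfl, rfl⟩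

theorem runsRandomAlgorithm_universal : RunsRandomAlgorithm universal :=
  ⟨fun A => frame A.word, fun _ _ h => LAlgorithm.word_injective (eq_of_frame_prefix h),
    fun _ _ _ _ h => universal_outputs h⟩

end LasVegas

theorem mainTheorem3 :
    (∃ U : LasVegas.LAlgorithm,
      LasVegas.RunsRandomAlgorithm U ∧ LasVegas.Complete U.family) ∧
    (∀ p : LasVegas.Family, LasVegas.Complete p →
      ∃ A : LasVegas.LAlgorithm,
        (∀ (f : List Bool → List Bool) (x : List Bool),
          A.inversionProb f x = LasVegas.twoPow (-LasVegas.Kl p (f ⁻¹' {x}) x)) ∧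
        ∀ B : LasVegas.LAlgorithm, ∃ c : NNReal,
          ∀ (f : List Bool → List Bool) (x : List Bool),
            B.inversionProb f x ≤ c * A.inversionProb f x) := by
  refine ⟨⟨LasVegas.universal, LasVegas.runsRandomAlgorithm_universal,
    LasVegas.complete_of_runsRandomAlgorithm LasVegas.runsRandomAlgorithm_universal⟩, ?_⟩
  rintro _ ⟨⟨A, rfl⟩, hmax⟩
  refine ⟨A, fun f x => ?_, fun B => ?_⟩
  · rw [LasVegas.twoPow_neg_Kl, A.inversionProb_eq_prob]
  · obtain ⟨c, hc⟩ := hmax B.family ⟨B, rfl⟩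
    refine ⟨c, fun f x => ?_⟩
    rw [A.inversionProb_eq_prob, B.inversionProb_eq_prob]
    exact LasVegas.prob_le_of_le hc _ x
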